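/- Let $\mathbf{Hilb}$ be the category of complex Hilbert spaces and bounded linear maps, with the Hilbertian tensor product $\hat\otimes_2$ (the completed tensor product), its associativity constraint $\alpha$ and symmetry constraint $\sigma$; write $f^\dagger$ for the Hilbert adjoint of a bounded linear map $f$. A commutative Hilbertian Frobenius semigroup is a pair $(H,\mu)$ of a Hilbert space $H$ and a bounded linear map $\mu\colon H\hat\otimes_2 H\to H$ that is associative ($\mu\circ(\mu\hat\otimes_2 \mathrm{id})=\mu\circ(\mathrm{id}\hat\otimes_2\mu)\circ\alpha$), commutative ($\mu\circ\sigma=\mu$) and satisfies the Frobenius condition $$(\mu\hat\otimes_2\mathrm{id})\circ\alpha^{-1}\circ(\mathrm{id}\hat\otimes_2\mu^\dagger)=\mu^\dagger\circ\mu=(\mathrm{id}\hat\otimes_2\mu)\circ\alpha\circ(\mu^\dagger\hat\otimes_2\mathrm{id}).$$ A morphism $(H,\mu)\to(K,\gamma)$ is a bounded linear map $f$ with $f\circ\mu=\gamma\circ(f\hat\otimes_2 f)$. Let $J(H,\mu)$ be the Jacobson radical of the algebra $H$ with product $xy=\mu(x\otimes y)$, that is, the intersection of its maximal modular ideals ($J(H,\mu)=H$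 if there are none). Call $(H,\mu)$ semisimple if $J(H,\mu)=0$. Then the category ${}_c\mathbf{FrobSem}(\mathbb{Hilb})$ of commutative Hilbertian Frobenius semigroups is equivalent to the product ${}_{\mathsf{semisimple},c}\mathbf{FrobSem}(\mathbb{Hilb})\times\mathbf{Hilb}$, where the first factor is the full subcategory of semisimple objects. More precisely, for every object $(H,\mu)$ the radical $J(H,\mu)$ is closed, and $J(H,\mu)^\perp$ is a subalgebra which, with the restricted product $\mu|_{J(H,\mu)^\perp}$, is a semisimple commutative Hilbertian Frobenius semigroup; every morphism $f\colon(H,\mu)\to(K,\gamma)$ maps $J(H,\mu)$ into $J(K,\gamma)$ and $J(H,\mu)^\perp$ into $J(K,\gamma)^\perp$; and the resulting functor $$(H,\mu)\mapsto\bigl((J(H,\mu)^\perp,\mu|_{J(H,\mu)^\perp}),\,J(H,\mu)\bigr),\qquad f\mapsto\bigl(f|_{J(H,\mu)^\perp},\,f|_{J(H,\mu)}\bigr)$$ is an equivalence of categories. -/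

import Mathlib

open CategoryTheory
open scoped TensorProduct

universe u

noncomputable section

namespace HilbFrob

/-! ### The Hilbertian tensor product -/

section Tensor

variable {E F G H E' F' G' E'' F'' : Type*}
  [NormedAddCommGroup E] [InnerProductSpace ℂ E] [NormedAddCommGroup F] [InnerProductSpace ℂ F]
  [NormedAddCommGroup G] [InnerProductSpace ℂ G] [NormedAddCommGroup H] [InnerProductSpace ℂ H]
  [NormedAddCommGroup E'] [InnerProductSpace ℂ E'] [NormedAddCommGroup F'] [InnerProductSpace ℂ F']
  [NormedAddCommGroup G'] [InnerProductSpace ℂ G']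
  [NormedAddCommGroup E''] [InnerProductSpace ℂ E'']
  [NormedAddCommGroup F''] [InnerProductSpace ℂ F'']

/-- The Hilbertian tensor product: the completion of the algebraic tensor product over `ℂ`
for the inner product `⟪x ⊗ y, x' ⊗ y'⟫ = ⟪x, x'⟫ * ⟪y, y'⟫`. -/
abbrev HTensor (E F : Type*) [NormedAddCommGroup E] [InnerProductSpace ℂ E]
    [NormedAddCommGroup F] [InnerProductSpace ℂ F] : Type _ :=
  UniformSpace.Completion (E ⊗[ℂ] F)

/-- The elementary tensor `x ⊗ y` in the Hilbertian tensor product. -/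
def htmul (x : E) (y : F) : HTensor E F := ((x ⊗ₜ[ℂ] y : E ⊗[ℂ] F) : UniformSpace.Completion _)

/-- The tensor product of two bounded linear maps, extended to the completions. -/
def hmap (f : E →L[ℂ] E') (g : F →L[ℂ] F') : HTensor E F →L[ℂ] HTensor E' F' :=
  ((UniformSpace.Completion.toComplL (𝕜 := ℂ)).comp (TensorProduct.mapL f g)).extend
    (UniformSpace.Completion.toComplL (𝕜 := ℂ) (E := E ⊗[ℂ] F))

theorem hmap_coe (f : E →L[ℂ] E') (g : F →L[ℂ] F') (t : E ⊗[ℂ] F) :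
    hmap f g (t : HTensor E F) = ((TensorProduct.mapL f g t : E' ⊗[ℂ] F') : HTensor E' F') :=
  ContinuousLinearMap.extend_eq
    ((UniformSpace.Completion.toComplL (𝕜 := ℂ)).comp (TensorProduct.mapL f g))
    (e := UniformSpace.Completion.toComplL (𝕜 := ℂ) (E := E ⊗[ℂ] F))
    UniformSpace.Completion.denseRange_coe
    (UniformSpace.Completion.isUniformInducing_coe _) t

@[simp] theorem hmap_htmul (f : E →L[ℂ] E') (g : F →L[ℂ] F') (x : E) (y : F) :
    hmap f g (htmul x y) = htmul (f x) (g y) := by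
  rw [htmul, hmap_coe]
  rfl

theorem continuous_htmul : Continuous fun p : E × F => (htmul p.1 p.2 : HTensor E F) :=
  (UniformSpace.Completion.continuous_coe _).comp TensorProduct.continuous_tmul

/-- Bounded linear maps agreeing on elementary tensors are equal. -/
theorem hext {f g : HTensor E F →L[ℂ] H} (h : ∀ x y, f (htmul x y) = g (htmul x y)) : f = g := by
  ext t
  induction t using UniformSpace.Completion.induction_on with
  | hp => exact isClosed_eq f.continuous g.continuous
  | ih a =>
    induction a using TensorProduct.induction_on with
    | zero => rw [UniformSpace.Completion.coe_zero, map_zero, map_zero]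
    | tmul x y => exact h x y
    | add a b ha hb => rw [UniformSpace.Completion.coe_add, map_add, map_add, ha, hb]

theorem hext₃ {f g : HTensor (HTensor E F) G →L[ℂ] H}
    (h : ∀ x y z, f (htmul (htmul x y) z) = g (htmul (htmul x y) z)) : f = g := by
  refine hext fun t z => ?_
  induction t using UniformSpace.Completion.induction_on with
  | hp =>
    have hc : Continuous fun t : HTensor E F => (htmul t z : HTensor (HTensor E F) G) :=
      continuous_htmul.comp (by fun_prop : Continuous fun t : HTensor E F => (t, z))
    exact isClosed_eq (f.continuous.comp hc) (g.continuous.comp hc)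
  | ih a =>
    induction a using TensorProduct.induction_on with
    | zero =>
      have : (htmul ((0 : E ⊗[ℂ] F) : HTensor E F) z : HTensor (HTensor E F) G) = 0 := by
        rw [htmul, UniformSpace.Completion.coe_zero, TensorProduct.zero_tmul,
          UniformSpace.Completion.coe_zero]
      rw [this, map_zero, map_zero]
    | tmul x y => exact h x y z
    | add a b ha hb =>
      have : (htmul ((a + b : E ⊗[ℂ] F) : HTensor E F) z : HTensor (HTensor E F) G)
          = htmul (a : HTensor E F) z + htmul (b : HTensor E F) z := by
        rw [htmul, UniformSpace.Completion.coe_add, TensorProduct.add_tmul,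
          UniformSpace.Completion.coe_add]
        rfl
      rw [this, map_add, map_add, ha, hb]

theorem hmap_comp (f : E →L[ℂ] E') (f' : E' →L[ℂ] E'') (g : F →L[ℂ] F') (g' : F' →L[ℂ] F'') :
    hmap (f'.comp f) (g'.comp g) = (hmap f' g').comp (hmap f g) :=
  hext fun x y => by simp

@[simp] theorem hmap_id :
    hmap (ContinuousLinearMap.id ℂ E) (ContinuousLinearMap.id ℂ F) = ContinuousLinearMap.id ℂ _ :=
  hext fun x y => by simp

/-- The symmetry constraint `x ⊗ y ↦ y ⊗ x`, a unitary. -/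
def hcomm (E F : Type*) [NormedAddCommGroup E] [InnerProductSpace ℂ E]
    [NormedAddCommGroup F] [InnerProductSpace ℂ F] : HTensor E F ≃ₗᵢ[ℂ] HTensor F E :=
  (TensorProduct.comm ℂ E F).extendOfIsometry
    (UniformSpace.Completion.toComplₗᵢ (𝕜 := ℂ) (E := E ⊗[ℂ] F)).toLinearMap
    (UniformSpace.Completion.toComplₗᵢ (𝕜 := ℂ) (E := F ⊗[ℂ] E)).toLinearMap
    UniformSpace.Completion.denseRange_coe UniformSpace.Completion.denseRange_coe
    (fun x => by simp)

@[simp] theorem hcomm_htmul (x : E) (y : F) : hcomm E F (htmul x y) = htmul y x :=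
  LinearEquiv.extendOfIsometry_eq (TensorProduct.comm ℂ E F) _ _ _ _ _ (x ⊗ₜ y)

/-- The inclusion of `(E ⊗ F) ⊗ G` in its double completion. -/
def inclL (E F G : Type*) [NormedAddCommGroup E] [InnerProductSpace ℂ E]
    [NormedAddCommGroup F] [InnerProductSpace ℂ F] [NormedAddCommGroup G] [InnerProductSpace ℂ G] :
    (E ⊗[ℂ] F) ⊗[ℂ] G →ₗᵢ[ℂ] HTensor (HTensor E F) G :=
  UniformSpace.Completion.toComplₗᵢ.comp
    ((UniformSpace.Completion.toComplₗᵢ (𝕜 := ℂ) (E := E ⊗[ℂ] F)).rTensor G)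

/-- The inclusion of `E ⊗ (F ⊗ G)` in its double completion. -/
def inclR (E F G : Type*) [NormedAddCommGroup E] [InnerProductSpace ℂ E]
    [NormedAddCommGroup F] [InnerProductSpace ℂ F] [NormedAddCommGroup G] [InnerProductSpace ℂ G] :
    E ⊗[ℂ] (F ⊗[ℂ] G) →ₗᵢ[ℂ] HTensor E (HTensor F G) :=
  UniformSpace.Completion.toComplₗᵢ.comp
    ((UniformSpace.Completion.toComplₗᵢ (𝕜 := ℂ) (E := F ⊗[ℂ] G)).lTensor E)

theorem denseRange_map {f : E →ₗᵢ[ℂ] E'} {g : F →ₗᵢ[ℂ] F'} (hf : DenseRange f)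
    (hg : DenseRange g) : DenseRange (TensorProduct.mapIsometry f g) := by
  have hmem : ∀ t, t ∈ closure (Set.range (TensorProduct.mapIsometry f g)) := by
    intro t
    have hcl : ∀ t, t ∈ closure (Set.range (TensorProduct.mapIsometry f g)) ↔
        t ∈ (LinearMap.range (TensorProduct.mapIsometry f g).toLinearMap).topologicalClosure := by
      intro t; rfl
    rw [hcl]
    induction t using TensorProduct.induction_on with
    | zero => exact zero_mem _
    | add a b ha hb => exact add_mem ha hb
    | tmul x y =>
      rw [← hcl]
      have hc : Continuous fun p : E' × F' => p.1 ⊗ₜ[ℂ] p.2 := TensorProduct.continuous_tmul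
      have hd : DenseRange (Prod.map f g) := hf.prodMap hg
      refine closure_mono ?_ (hc.range_subset_closure_image_dense hd ⟨(x, y), rfl⟩)
      rintro _ ⟨_, ⟨p, rfl⟩, rfl⟩
      exact ⟨p.1 ⊗ₜ p.2, by simp⟩
  exact hmem

theorem denseRange_inclL : DenseRange (inclL E F G) :=
  UniformSpace.Completion.denseRange_coe.comp
    (denseRange_map UniformSpace.Completion.denseRange_coe Function.surjective_id.denseRange)
    (UniformSpace.Completion.continuous_coe _)

theorem denseRange_inclR : DenseRange (inclR E F G) :=
  UniformSpace.Completion.denseRange_coe.comp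
    (denseRange_map Function.surjective_id.denseRange UniformSpace.Completion.denseRange_coe)
    (UniformSpace.Completion.continuous_coe _)

/-- The associativity constraint `(x ⊗ y) ⊗ z ↦ x ⊗ (y ⊗ z)`, a unitary. -/
def hassoc (E F G : Type*) [NormedAddCommGroup E] [InnerProductSpace ℂ E]
    [NormedAddCommGroup F] [InnerProductSpace ℂ F] [NormedAddCommGroup G] [InnerProductSpace ℂ G] :
    HTensor (HTensor E F) G ≃ₗᵢ[ℂ] HTensor E (HTensor F G) :=
  (TensorProduct.assoc ℂ E F G).extendOfIsometry
    (inclL E F G).toLinearMap (inclR E F G).toLinearMap denseRange_inclL denseRange_inclR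
    (fun x => ((inclR E F G).norm_map _).trans
      ((TensorProduct.norm_assoc x).trans ((inclL E F G).norm_map x).symm))

@[simp] theorem hassoc_htmul (x : E) (y : F) (z : G) :
    hassoc E F G (htmul (htmul x y) z) = htmul x (htmul y z) :=
  LinearEquiv.extendOfIsometry_eq (TensorProduct.assoc ℂ E F G) (inclL E F G).toLinearMap
    (inclR E F G).toLinearMap denseRange_inclL denseRange_inclR _ ((x ⊗ₜ y) ⊗ₜ z)

end Tensor

/-! ### Bounded multiplications on a Hilbert space -/

section Mul

variable {H : Type*} [NormedAddCommGroup H] [InnerProductSpace ℂ H]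

/-- Associativity, as a commuting diagram: `μ ∘ (μ ⊗ id) = μ ∘ (id ⊗ μ) ∘ α`. -/
def IsAssoc (μ : HTensor H H →L[ℂ] H) : Prop :=
  μ ∘L hmap μ (.id ℂ H) = μ ∘L hmap (.id ℂ H) μ ∘L (hassoc H H H : _ →L[ℂ] _)

/-- Commutativity: `μ ∘ σ = μ`. -/
def IsComm (μ : HTensor H H →L[ℂ] H) : Prop :=
  μ ∘L (hcomm H H : _ →L[ℂ] _) = μ

/-- The dagger-Frobenius condition (both cells):
`(μ ⊗ id) ∘ α⁻¹ ∘ (id ⊗ μ†) = μ† ∘ μ` and `(id ⊗ μ) ∘ α ∘ (μ† ⊗ id) = μ† ∘ μ`. -/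
def IsFrobenius [CompleteSpace H] (μ : HTensor H H →L[ℂ] H) : Prop :=
  hmap μ (.id ℂ H) ∘L ((hassoc H H H).symm : _ →L[ℂ] _) ∘L
      hmap (.id ℂ H) (ContinuousLinearMap.adjoint μ) = ContinuousLinearMap.adjoint μ ∘L μ ∧
  hmap (.id ℂ H) μ ∘L (hassoc H H H : _ →L[ℂ] _) ∘L
      hmap (ContinuousLinearMap.adjoint μ) (.id ℂ H) = ContinuousLinearMap.adjoint μ ∘L μ

/-- Left ideals of the underlying (non-unital) complex algebra, with product
`xy = μ (x ⊗ y)`. -/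
def IsLeftIdeal (μ : HTensor H H →L[ℂ] H) (I : Submodule ℂ H) : Prop :=
  ∀ x y, y ∈ I → μ (htmul x y) ∈ I

/-- `I` is modular: there is a right identity `e` modulo `I`. -/
def IsModular (μ : HTensor H H →L[ℂ] H) (I : Submodule ℂ H) : Prop :=
  ∃ e, ∀ x, x - μ (htmul x e) ∈ I

/-- Maximal modular left ideals: modular, and maximal among the proper left ideals. -/
def IsMaximalModular (μ : HTensor H H →L[ℂ] H) (I : Submodule ℂ H) : Prop :=
  IsModular μ I ∧ Maximal (fun K => IsLeftIdeal μ K ∧ K ≠ ⊤) I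

/-- The Jacobson radical: the intersection of all maximal modular left ideals
(the whole algebra if there are none). -/
def jacobson (μ : HTensor H H →L[ℂ] H) : Submodule ℂ H :=
  sInf {I | IsMaximalModular μ I}

/-- `V` is closed under multiplication: `μ (V ⊗ V) ⊆ V`. -/
def IsSubalgebra (μ : HTensor H H →L[ℂ] H) (V : Submodule ℂ H) : Prop :=
  ∀ t : HTensor V V, μ (hmap V.subtypeL V.subtypeL t) ∈ V

/-- The restriction and co-restriction of `μ` to a subalgebra. -/
def restrictMul (μ : HTensor H H →L[ℂ] H) (V : Submodule ℂ H) (hV : IsSubalgebra μ V) :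
    HTensor V V →L[ℂ] V :=
  (μ ∘L hmap V.subtypeL V.subtypeL).codRestrict V hV

@[simp] theorem coe_restrictMul_htmul (μ : HTensor H H →L[ℂ] H) (V : Submodule ℂ H)
    (hV : IsSubalgebra μ V) (x y : V) :
    (restrictMul μ V hV (htmul x y) : H) = μ (htmul (x : H) (y : H)) :=
  congrArg μ (hmap_htmul V.subtypeL V.subtypeL x y)

theorem restrict_comp_restrictMul {K : Type*} [NormedAddCommGroup K] [InnerProductSpace ℂ K]
    {μ : HTensor H H →L[ℂ] H} {γ : HTensor K K →L[ℂ] K} {f : H →L[ℂ] K}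
    (hμγ : f ∘L μ = γ ∘L hmap f f) {V : Submodule ℂ H} {W : Submodule ℂ K}
    (hV : IsSubalgebra μ V) (hW : IsSubalgebra γ W) (hf : ∀ x ∈ V, f x ∈ W) :
    f.restrict hf ∘L restrictMul μ V hV =
      restrictMul γ W hW ∘L hmap (f.restrict hf) (f.restrict hf) :=
  hext fun x y => by
    have h : f (μ (htmul (x : H) (y : H))) = γ (htmul (f x) (f y)) := by
      simpa using DFunLike.congr_fun hμγ (htmul (x : H) (y : H))
    rw [ContinuousLinearMap.comp_apply, ContinuousLinearMap.comp_apply, hmap_htmul]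
    apply Subtype.ext
    rw [coe_restrictMul_htmul]
    exact (congrArg f (coe_restrictMul_htmul μ V hV x y)).trans h

theorem isAssoc_iff (μ : HTensor H H →L[ℂ] H) :
    IsAssoc μ ↔ ∀ x y z, μ (htmul (μ (htmul x y)) z) = μ (htmul x (μ (htmul y z))) := by
  refine ⟨fun h x y z => ?_, fun h => hext₃ fun x y z => ?_⟩
  · simpa using DFunLike.congr_fun h (htmul (htmul x y) z)
  · simpa using h x y z

theorem isComm_iff (μ : HTensor H H →L[ℂ] H) :
    IsComm μ ↔ ∀ x y, μ (htmul y x) = μ (htmul x y) := by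
  refine ⟨fun h x y => ?_, fun h => hext fun x y => ?_⟩
  · simpa using DFunLike.congr_fun h (htmul x y)
  · simpa using h x y

theorem IsAssoc.restrict {μ : HTensor H H →L[ℂ] H} (h : IsAssoc μ) (V : Submodule ℂ H)
    (hV : IsSubalgebra μ V) : IsAssoc (restrictMul μ V hV) := by
  rw [isAssoc_iff] at h ⊢
  intro x y z
  ext
  simpa using h x y z

theorem IsComm.restrict {μ : HTensor H H →L[ℂ] H} (h : IsComm μ) (V : Submodule ℂ H)
    (hV : IsSubalgebra μ V) : IsComm (restrictMul μ V hV) := by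
  rw [isComm_iff] at h ⊢
  intro x y
  ext
  simpa using h x y

end Mul

/-! ### The categories -/

/-- Complex Hilbert spaces. -/
structure Hilb : Type (u + 1) where
  carrier : Type u
  [normed : NormedAddCommGroup carrier]
  [innerProduct : InnerProductSpace ℂ carrier]
  [complete : CompleteSpace carrier]

attribute [instance] Hilb.normed Hilb.innerProduct Hilb.complete

/-- Morphisms of Hilbert spaces: bounded linear maps. -/
@[ext] structure Hilb.Hom (H K : Hilb.{u}) : Type u where
  toCLM : H.carrier →L[ℂ] K.carrier

instance : Category Hilb.{u} where
  Hom := Hilb.Hom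
  id H := ⟨.id ℂ H.carrier⟩
  comp f g := ⟨g.toCLM ∘L f.toCLM⟩

/-- Commutative semigroup objects in the symmetric monoidal category of Hilbert spaces. -/
structure CSem : Type (u + 1) extends Hilb.{u} where
  mul : HTensor carrier carrier →L[ℂ] carrier
  assoc : IsAssoc mul
  comm : IsComm mul

/-- Semigroup morphisms: bounded linear maps `f` with `f ∘ μ = γ ∘ (f ⊗ f)`. -/
@[ext] structure CSem.Hom (X Y : CSem.{u}) : Type u where
  toCLM : X.carrier →L[ℂ] Y.carrier
  map_mul : toCLM ∘L X.mul = Y.mul ∘L hmap toCLM toCLM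

instance : Category CSem.{u} where
  Hom := CSem.Hom
  id X := ⟨.id ℂ X.carrier, by simp⟩
  comp f g := ⟨g.toCLM ∘L f.toCLM, by
    rw [ContinuousLinearMap.comp_assoc, f.map_mul, ← ContinuousLinearMap.comp_assoc, g.map_mul,
      ContinuousLinearMap.comp_assoc, hmap_comp]⟩

/-- The category of commutative Hilbertian Frobenius semigroups, a full subcategory of the
category of commutative semigroups. -/
abbrev CFrobSem : Type (u + 1) :=
  ObjectProperty.FullSubcategory fun X : CSem.{u} => IsFrobenius X.mul

/-- The Jacobson radical `J(H, μ)` of an object. -/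
abbrev radical (X : CFrobSem.{u}) : Submodule ℂ X.obj.carrier := jacobson X.obj.mul

/-- The full subcategory of semisimple objects: those with zero radical. -/
abbrev SemisimpleCFrobSem : Type (u + 1) :=
  ObjectProperty.FullSubcategory fun X : CFrobSem.{u} => radical X = ⊥

/-- A closed subalgebra as a commutative semigroup on its own, with the restricted product. -/
def CSem.restrict (X : CSem.{u}) (V : Submodule ℂ X.carrier) [CompleteSpace V]
    (hV : IsSubalgebra X.mul V) : CSem.{u} where
  carrier := V
  mul := restrictMul X.mul V hV
  assoc := X.assoc.restrict V hV
  comm := X.comm.restrict V hV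

/-- A morphism restricts to subalgebras that it maps into each other. -/
def CSem.Hom.restrict {X Y : CSem.{u}} (f : X ⟶ Y) {V : Submodule ℂ X.carrier}
    {W : Submodule ℂ Y.carrier} [CompleteSpace V] [CompleteSpace W]
    (hV : IsSubalgebra X.mul V) (hW : IsSubalgebra Y.mul W)
    (hf : ∀ x ∈ V, f.toCLM x ∈ W) : X.restrict V hV ⟶ Y.restrict W hW where
  toCLM := f.toCLM.restrict hf
  map_mul := restrict_comp_restrictMul f.map_mul hV hW hf

/-! ### The two functors

Their well-definedness (that `Jᗮ` is a semisimple Frobenius subalgebra, that `J` is closed, and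
that morphisms preserve both) is not built in; it enters through the arguments below. -/

/-- `P(H, μ) = (Jᗮ, μ restricted to Jᗮ)` and `P(f)` is `f` restricted to the complements. -/
def functorP
    (hsub : ∀ X : CFrobSem.{u}, IsSubalgebra X.obj.mul (radical X)ᗮ)
    (hfrob : ∀ X : CFrobSem.{u}, IsFrobenius (restrictMul X.obj.mul (radical X)ᗮ (hsub X)))
    (hss : ∀ X : CFrobSem.{u}, jacobson (restrictMul X.obj.mul (radical X)ᗮ (hsub X)) = ⊥)
    (hmaps : ∀ (X Y : CFrobSem.{u}) (f : X ⟶ Y), ∀ x ∈ (radical X)ᗮ, f.hom.toCLM x ∈ (radical Y)ᗮ) :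
    CFrobSem.{u} ⥤ SemisimpleCFrobSem.{u} where
  obj X := ⟨⟨X.obj.restrict (radical X)ᗮ (hsub X), hfrob X⟩, hss X⟩
  map {X Y} f := ObjectProperty.homMk (ObjectProperty.homMk
    (CSem.Hom.restrict f.hom (hsub X) (hsub Y) (hmaps X Y f)))
  map_id _ := rfl
  map_comp _ _ := rfl

/-- `J(H, μ)` as a Hilbert space, and `J(f)` is `f` restricted to the radicals. -/
def functorJ
    (hclosed : ∀ X : CFrobSem.{u}, IsClosed (radical X : Set X.obj.carrier))
    (hmaps : ∀ (X Y : CFrobSem.{u}) (f : X ⟶ Y), ∀ x ∈ radical X, f.hom.toCLM x ∈ radical Y) :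
    CFrobSem.{u} ⥤ Hilb.{u} where
  obj X := @Hilb.mk (radical X) _ _ (hclosed X).completeSpace_coe
  map {X Y} f := ⟨f.hom.toCLM.restrict (hmaps X Y f)⟩
  map_id _ := rfl
  map_comp _ _ := rfl

end HilbFrob

end

/-!
The Frobenius condition says that the adjoint of every multiplication operator `L_x` commutes with
multiplications. By commutativity `L_x` is then normal, and Fuglede's theorem makes associativity
automatic. Elements of the radical `J` are quasi-regular, so for `x ∈ J` the normal operator `L_x`
has spectrum `{0}` and vanishes: `J` is the annihilator of the algebra. As `L_x` and `L_x†` have the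
same kernel, `J` is also the orthogonal complement of the range of `μ`, and `x * x = 0` forces
`x ∈ J`. Morphisms preserve elements of square zero and the closure of the range of the product,
hence both `J` and `Jᗮ`. Since a product depends only on the components in `Jᗮ`, the semigroup is
the orthogonal sum of the semisimple `Jᗮ` and of `J` with zero product.
-/

noncomputable section

namespace HilbFrob

open scoped InnerProduct

section Tensor

variable {E F G E' F' : Type*}
  [NormedAddCommGroup E] [InnerProductSpace ℂ E] [NormedAddCommGroup F] [InnerProductSpace ℂ F]
  [NormedAddCommGroup G] [InnerProductSpace ℂ G]
  [NormedAddCommGroup E'] [InnerProductSpace ℂ E'] [NormedAddCommGroup F'] [InnerProductSpace ℂ F']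

theorem inner_htmul (x x' : E) (y y' : F) :
    inner ℂ (htmul x y) (htmul x' y') = inner ℂ x x' * inner ℂ y y' := by
  rw [htmul, htmul, UniformSpace.Completion.inner_coe, TensorProduct.inner_tmul]

theorem hassoc_symm_htmul (x : E) (y : F) (z : G) :
    (hassoc E F G).symm (htmul x (htmul y z)) = htmul (htmul x y) z := by
  rw [LinearIsometryEquiv.symm_apply_eq, hassoc_htmul]

/-- The elementary tensor `htmul` as a bounded bilinear map. -/
def htmulL (E F : Type*) [NormedAddCommGroup E] [InnerProductSpace ℂ E]
    [NormedAddCommGroup F] [InnerProductSpace ℂ F] : E →L[ℂ] F →L[ℂ] HTensor E F :=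
  .compL ℂ F (E ⊗[ℂ] F) (HTensor E F) UniformSpace.Completion.toComplL ∘L TensorProduct.mkL ℂ E F

@[simp] theorem htmulL_apply_apply (x : E) (y : F) : htmulL E F x y = htmul x y := rfl

theorem adjoint_hmap [CompleteSpace E] [CompleteSpace F] [CompleteSpace E'] [CompleteSpace F']
    (f : E →L[ℂ] E') (g : F →L[ℂ] F') : (hmap f g)† = hmap (f†) (g†) := by
  refine hext fun x y => ext_inner_right ℂ fun t => ?_
  have h : innerSL ℂ (htmul x y) ∘L hmap f g = innerSL ℂ (htmul ((f†) x) ((g†) y)) :=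
    hext fun u v => by simp [inner_htmul, ContinuousLinearMap.adjoint_inner_left]
  simpa [ContinuousLinearMap.adjoint_inner_left] using DFunLike.congr_fun h t

theorem mem_orthogonal_range_iff (f : HTensor E F →L[ℂ] G) (z : G) :
    z ∈ f.rangeᗮ ↔ ∀ x y, inner ℂ z (f (htmul x y)) = 0 := by
  refine ⟨fun hz x y => f.range.inner_left_of_mem_orthogonal ⟨_, rfl⟩ hz, fun h => ?_⟩
  have hzf : innerSL ℂ z ∘L f = 0 := hext fun x y => by simpa using h x y
  rintro _ ⟨t, rfl⟩
  exact inner_eq_zero_symm.1 (DFunLike.congr_fun hzf t)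

end Tensor

section Frobenius

variable {H : Type*} [NormedAddCommGroup H] [InnerProductSpace ℂ H]
  {μ : HTensor H H →L[ℂ] H}

/-- The left regular representation `x ↦ (y ↦ xy)` of the algebra with product
`xy = μ (x ⊗ y)`. -/
def lmul (μ : HTensor H H →L[ℂ] H) : H →L[ℂ] H →L[ℂ] H :=
  .compL ℂ H (HTensor H H) H μ ∘L htmulL H H

@[simp] theorem lmul_apply_apply (μ : HTensor H H →L[ℂ] H) (x y : H) :
    lmul μ x y = μ (htmul x y) := rfl

theorem IsAssoc.lmul_mul (ha : IsAssoc μ) (x y : H) :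
    lmul μ (μ (htmul x y)) = lmul μ x * lmul μ y :=
  ContinuousLinearMap.ext ((isAssoc_iff μ).1 ha x y)

theorem IsComm.lmul_comm (hc : IsComm μ) (x y : H) : lmul μ x y = lmul μ y x :=
  (isComm_iff μ).1 hc y x

theorem IsAssoc.commute_lmul (ha : IsAssoc μ) (hc : IsComm μ) (x y : H) :
    Commute (lmul μ x) (lmul μ y) := by
  rw [Commute, SemiconjBy, ← ha.lmul_mul, ← ha.lmul_mul]
  exact congrArg (lmul μ) (hc.lmul_comm x y)

variable [CompleteSpace H]

theorem isFrobenius_iff_left : IsFrobenius μ ↔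
    hmap μ (.id ℂ H) ∘L ((hassoc H H H).symm : _ →L[ℂ] _) ∘L hmap (.id ℂ H) (μ†) = μ† ∘L μ := by
  refine ⟨And.left, fun h => ⟨h, ?_⟩⟩
  have h' := congrArg ContinuousLinearMap.adjoint h
  simp only [ContinuousLinearMap.adjoint_comp, adjoint_hmap, ContinuousLinearMap.comp_assoc,
    LinearIsometryEquiv.adjoint_eq_symm, ContinuousLinearMap.adjoint_id,
    ContinuousLinearMap.adjoint_adjoint, LinearIsometryEquiv.symm_symm] at h'
  exact h'

theorem isFrobenius_iff_adjoint_lmul : IsFrobenius μ ↔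
    ∀ x u v, ((lmul μ x)†) (μ (htmul u v)) = μ (htmul (((lmul μ x)†) u) v) := by
  have hcell (x : H) : (hmap μ (.id ℂ H) ∘L ((hassoc H H H).symm : _ →L[ℂ] _)) ∘L
      htmulL H (HTensor H H) x = hmap (lmul μ x) (.id ℂ H) :=
    hext fun u v => by simp [hassoc_symm_htmul]
  have hleft : IsFrobenius μ ↔ ∀ x, hmap (lmul μ x) (.id ℂ H) ∘L μ† = μ† ∘L lmul μ x := by
    simp only [isFrobenius_iff_left, ← hcell]
    exact ⟨fun h x => ContinuousLinearMap.ext fun y => by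
        simpa using DFunLike.congr_fun h (htmul x y),
      fun h => hext fun x y => by simpa using DFunLike.congr_fun (h x) y⟩
  have hadj (x : H) : (hmap (lmul μ x) (.id ℂ H) ∘L μ† = μ† ∘L lmul μ x) ↔
      ∀ u v, ((lmul μ x)†) (μ (htmul u v)) = μ (htmul (((lmul μ x)†) u) v) := by
    rw [← ContinuousLinearMap.adjoint.injective.eq_iff]
    simp only [ContinuousLinearMap.adjoint_comp, adjoint_hmap,
      ContinuousLinearMap.adjoint_id, ContinuousLinearMap.adjoint_adjoint]
    exact ⟨fun h u v => by simpa using (DFunLike.congr_fun h (htmul u v)).symm,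
      fun h => hext fun u v => by simp [h]⟩
  simp only [hleft, hadj]

theorem IsFrobenius.commute_star_lmul (h : IsFrobenius μ) (hc : IsComm μ) (x y : H) :
    Commute (star (lmul μ x)) (lmul μ y) := by
  refine ContinuousLinearMap.ext fun z => ?_
  have hz := isFrobenius_iff_adjoint_lmul.1 h x z y
  simp only [← lmul_apply_apply, hc.lmul_comm _ y] at hz
  exact hz

theorem IsFrobenius.isStarNormal_lmul (h : IsFrobenius μ) (hc : IsComm μ) (x : H) :
    IsStarNormal (lmul μ x) :=
  ⟨h.commute_star_lmul hc x x⟩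

theorem IsFrobenius.commute_lmul (h : IsFrobenius μ) (hc : IsComm μ) (x y : H) :
    Commute (lmul μ x) (lmul μ y) := by
  -- Fuglede's theorem, for the normal operator `star (lmul μ x)`
  simpa using (h.isStarNormal_lmul hc x).star.commute_star_left (h.commute_star_lmul hc x y)

theorem IsFrobenius.isAssoc (h : IsFrobenius μ) (hc : IsComm μ) : IsAssoc μ := by
  refine (isAssoc_iff μ).2 fun x y z => ?_
  have hxz := DFunLike.congr_fun (h.commute_lmul hc x z) y
  simp only [← lmul_apply_apply, hc.lmul_comm y z, hc.lmul_comm _ z]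
  exact hxz.symm

end Frobenius

section Radical

variable {H : Type*} [NormedAddCommGroup H] [InnerProductSpace ℂ H] {μ : HTensor H H →L[ℂ] H}

theorem isLeftIdeal_sSup {s : Set (Submodule ℂ H)} (hs : ∀ I ∈ s, IsLeftIdeal μ I) :
    IsLeftIdeal μ (sSup s) := by
  intro x
  have hle : sSup s ≤ (sSup s).comap (lmul μ x : H →ₗ[ℂ] H) :=
    sSup_le fun I hI y hy => Submodule.mem_sSup_of_mem hI (hs I hI x y hy)
  exact fun y hy => hle hy

theorem IsLeftIdeal.eq_top {I : Submodule ℂ H} (hI : IsLeftIdeal μ I) {e : H}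
    (he : ∀ x, x - μ (htmul x e) ∈ I) (heI : e ∈ I) : I = ⊤ :=
  Submodule.eq_top_iff'.2 fun x => by simpa using I.add_mem (he x) (hI x e heI)

theorem IsLeftIdeal.exists_isMaximalModular {I : Submodule ℂ H} (hI : IsLeftIdeal μ I) {e : H}
    (he : ∀ x, x - μ (htmul x e) ∈ I) (heI : e ∉ I) : ∃ M, IsMaximalModular μ M ∧ e ∉ M := by
  obtain ⟨M, hIM, hM⟩ := zorn_le_nonempty₀ {K : Submodule ℂ H | IsLeftIdeal μ K ∧ e ∉ K}
    (fun c hc hchain K hK => by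
      refine ⟨sSup c, ⟨isLeftIdeal_sSup fun L hL => (hc hL).1, fun heS => ?_⟩,
        fun L hL => le_sSup hL⟩
      obtain ⟨L, hL, heL⟩ := (Submodule.mem_sSup_of_directed ⟨K, hK⟩ hchain.directedOn).1 heS
      exact (hc hL).2 heL) I ⟨hI, heI⟩
  have hproper : M ≠ ⊤ := fun h => hM.prop.2 (h ▸ Submodule.mem_top)
  refine ⟨M, ⟨⟨e, fun x => hIM (he x)⟩, ⟨hM.prop.1, hproper⟩, ?_⟩, hM.prop.2⟩
  rintro K ⟨hK, hKtop⟩ hMK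
  exact hM.le_of_ge ⟨hK, fun heK => hKtop (hK.eq_top (fun x => hMK (hIM (he x))) heK)⟩ hMK

theorem isLeftIdeal_range_one_sub_lmul (ha : IsAssoc μ) (hc : IsComm μ) (y : H) :
    IsLeftIdeal μ (1 - lmul μ y).range := by
  rintro x _ ⟨z, rfl⟩
  have hcomm : Commute (1 - lmul μ y) (lmul μ x) :=
    (Commute.one_left _).sub_left (ha.commute_lmul hc y x)
  exact ⟨μ (htmul x z), DFunLike.congr_fun hcomm z⟩

theorem exists_sub_mul_eq_of_mem_jacobson (ha : IsAssoc μ) (hc : IsComm μ) {y : H}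
    (hy : y ∈ jacobson μ) : ∃ w, w - μ (htmul y w) = y := by
  have hmod (x : H) : x - μ (htmul x y) ∈ (1 - lmul μ y).range :=
    ⟨x, congrArg (x - ·) (hc.lmul_comm y x)⟩
  suffices y ∈ (1 - lmul μ y).range by simpa using this
  by_contra hyI
  obtain ⟨M, hM, hyM⟩ := (isLeftIdeal_range_one_sub_lmul ha hc y).exists_isMaximalModular hmod hyI
  exact hyM (Submodule.mem_sInf.1 hy M hM)

theorem isUnit_one_sub_lmul_of_mem_jacobson (ha : IsAssoc μ) (hc : IsComm μ) {y : H}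
    (hy : y ∈ jacobson μ) : IsUnit (1 - lmul μ y) := by
  obtain ⟨w, hw⟩ := exists_sub_mul_eq_of_mem_jacobson ha hc hy
  have hL : lmul μ w - lmul μ y * lmul μ w = lmul μ y := by
    rw [← ha.lmul_mul, ← map_sub, hw]
  have hcomm : Commute (1 - lmul μ y) (1 + lmul μ w) :=
    (Commute.one_left _).sub_left ((Commute.one_right _).add_right (ha.commute_lmul hc y w))
  have hinv : (1 - lmul μ y) * (1 + lmul μ w) = 1 :=
    calc (1 - lmul μ y) * (1 + lmul μ w)
        = 1 + (lmul μ w - lmul μ y * lmul μ w) - lmul μ y := by noncomm_ring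
      _ = 1 := by rw [hL, add_sub_cancel_right]
  exact ⟨⟨_, _, hinv, hcomm.symm.trans hinv⟩, rfl⟩

theorem spectrum_lmul_subset_of_mem_jacobson (ha : IsAssoc μ) (hc : IsComm μ) {x : H}
    (hx : x ∈ jacobson μ) : spectrum ℂ (lmul μ x) ⊆ {0} := by
  intro c hcs
  by_contra hc0
  have hunit := isUnit_one_sub_lmul_of_mem_jacobson ha hc ((jacobson μ).smul_mem c⁻¹ hx)
  rw [map_smul] at hunit
  exact hcs ((IsUnit.smul_sub_iff_sub_inv_smul (Units.mk0 c hc0) _).2 hunit)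

theorem ker_lmul_le_jacobson (μ : HTensor H H →L[ℂ] H) : (lmul μ).ker ≤ jacobson μ := by
  refine fun x hx => Submodule.mem_sInf.2 fun I ⟨⟨e, he⟩, _⟩ => ?_
  have hxe : μ (htmul x e) = 0 := DFunLike.congr_fun hx e
  simpa [hxe] using he x

end Radical

section FrobeniusRadical

variable {H : Type*} [NormedAddCommGroup H] [InnerProductSpace ℂ H] [CompleteSpace H]
  {μ : HTensor H H →L[ℂ] H}

theorem IsFrobenius.jacobson_eq_ker_lmul (h : IsFrobenius μ) (hc : IsComm μ) :
    jacobson μ = (lmul μ).ker := by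
  refine le_antisymm (fun x hx => ?_) (ker_lmul_le_jacobson μ)
  have := h.isStarNormal_lmul hc x
  exact CFC.eq_zero_of_spectrum_subset_zero (R := ℂ) (lmul μ x)
    (spectrum_lmul_subset_of_mem_jacobson (h.isAssoc hc) hc hx)

theorem IsFrobenius.mem_jacobson_iff (h : IsFrobenius μ) (hc : IsComm μ) {x : H} :
    x ∈ jacobson μ ↔ lmul μ x = 0 := by
  rw [h.jacobson_eq_ker_lmul hc]; rfl

theorem IsFrobenius.jacobson_eq_orthogonal_range (h : IsFrobenius μ) (hc : IsComm μ) :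
    jacobson μ = μ.rangeᗮ := by
  ext z
  simp_rw [mem_orthogonal_range_iff, h.mem_jacobson_iff hc, ← lmul_apply_apply,
    ← ContinuousLinearMap.adjoint_inner_left]
  have hker (x : H) : (∀ y, inner ℂ (((lmul μ x)†) z) y = 0) ↔ lmul μ z x = 0 := by
    rw [hc.lmul_comm z x,
      ← ContinuousLinearMap.IsStarNormal.adjoint_apply_eq_zero_iff (h.isStarNormal_lmul hc x)]
    exact ⟨fun hy => inner_self_eq_zero.1 (hy _), fun hx y => by rw [hx, inner_zero_left]⟩
  simp_rw [hker, ContinuousLinearMap.ext_iff, zero_apply]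

theorem IsFrobenius.isClosed_jacobson (h : IsFrobenius μ) (hc : IsComm μ) :
    IsClosed (jacobson μ : Set H) := by
  rw [h.jacobson_eq_orthogonal_range hc]
  exact Submodule.isClosed_orthogonal _

theorem IsFrobenius.orthogonal_jacobson_eq_closure_range (h : IsFrobenius μ) (hc : IsComm μ) :
    (jacobson μ)ᗮ = μ.range.topologicalClosure := by
  rw [h.jacobson_eq_orthogonal_range hc, Submodule.orthogonal_orthogonal_eq_closure]

theorem IsFrobenius.mul_mem_orthogonal_jacobson (h : IsFrobenius μ) (hc : IsComm μ)
    (t : HTensor H H) : μ t ∈ (jacobson μ)ᗮ := by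
  rw [h.orthogonal_jacobson_eq_closure_range hc]
  exact μ.range.le_topologicalClosure ⟨t, rfl⟩

theorem IsFrobenius.mem_jacobson_of_sq_eq_zero (h : IsFrobenius μ) (hc : IsComm μ) {x : H}
    (hx : μ (htmul x x) = 0) : x ∈ jacobson μ := by
  have hsq : lmul μ x * lmul μ x = 0 := by rw [← (h.isAssoc hc).lmul_mul, hx, map_zero]
  have hstar : star (lmul μ x) * lmul μ x = 0 := by
    ext y
    exact (ContinuousLinearMap.IsStarNormal.adjoint_apply_eq_zero_iff
      (h.isStarNormal_lmul hc x) _).2 (DFunLike.congr_fun hsq y)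
  exact (h.mem_jacobson_iff hc).2 (CStarRing.star_mul_self_eq_zero_iff _ |>.1 hstar)

theorem IsFrobenius.isSubalgebra_orthogonal_jacobson (h : IsFrobenius μ) (hc : IsComm μ) :
    IsSubalgebra μ (jacobson μ)ᗮ :=
  fun _ => h.mul_mem_orthogonal_jacobson hc _

theorem IsFrobenius.restrict (h : IsFrobenius μ) {V : Submodule ℂ H} [CompleteSpace V]
    (hV : IsSubalgebra μ V) (hstar : ∀ x ∈ V, ∀ y ∈ V, ((lmul μ x)†) y ∈ V) :
    IsFrobenius (restrictMul μ V hV) := by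
  have hadj (x : V) :
      (lmul (restrictMul μ V hV) x)† = ((lmul μ (x : H))†).restrict (hstar x x.2) := by
    refine ((ContinuousLinearMap.eq_adjoint_iff _ _).2 fun u v => ?_).symm
    simp [Submodule.coe_inner, ContinuousLinearMap.adjoint_inner_left]
  rw [isFrobenius_iff_adjoint_lmul] at h ⊢
  intro x u v
  ext
  simp [hadj, h]

theorem IsFrobenius.restrict_orthogonal_jacobson (h : IsFrobenius μ) (hc : IsComm μ)
    (hV : IsSubalgebra μ (jacobson μ)ᗮ) : IsFrobenius (restrictMul μ (jacobson μ)ᗮ hV) := by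
  refine h.restrict hV fun x _ y _ z hz => ?_
  have hzx : lmul μ x z = 0 := by rw [hc.lmul_comm, (h.mem_jacobson_iff hc).1 hz, zero_apply]
  rw [ContinuousLinearMap.adjoint_inner_right, hzx, inner_zero_left]

theorem IsFrobenius.jacobson_restrict_orthogonal_jacobson (h : IsFrobenius μ) (hc : IsComm μ)
    (hV : IsSubalgebra μ (jacobson μ)ᗮ) : jacobson (restrictMul μ (jacobson μ)ᗮ hV) = ⊥ := by
  refine (Submodule.eq_bot_iff _).2 fun x hx => ?_
  rw [(h.restrict_orthogonal_jacobson hc hV).mem_jacobson_iff (hc.restrict _ hV)] at hx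
  have hxx : μ (htmul (x : H) (x : H)) = 0 := by
    simpa using congrArg Subtype.val (DFunLike.congr_fun hx x)
  exact Subtype.ext (inner_self_eq_zero.1 (x.2 x (h.mem_jacobson_of_sq_eq_zero hc hxx)))

end FrobeniusRadical

section Morphism

variable {H K : Type*} [NormedAddCommGroup H] [InnerProductSpace ℂ H]
  [NormedAddCommGroup K] [InnerProductSpace ℂ K]
  {μ : HTensor H H →L[ℂ] H} {γ : HTensor K K →L[ℂ] K} {f : H →L[ℂ] K}

theorem comp_mul_eq_iff : f ∘L μ = γ ∘L hmap f f ↔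
    ∀ x y, f (μ (htmul x y)) = γ (htmul (f x) (f y)) :=
  ⟨fun h x y => by simpa using DFunLike.congr_fun h (htmul x y),
    fun h => hext fun x y => by simpa using h x y⟩

variable [CompleteSpace H] [CompleteSpace K]

theorem IsFrobenius.map_mem_jacobson (h : IsFrobenius μ) (hc : IsComm μ) (h' : IsFrobenius γ)
    (hc' : IsComm γ) (hf : f ∘L μ = γ ∘L hmap f f) {x : H} (hx : x ∈ jacobson μ) :
    f x ∈ jacobson γ := by
  have hxx : μ (htmul x x) = 0 := DFunLike.congr_fun ((h.mem_jacobson_iff hc).1 hx) x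
  exact h'.mem_jacobson_of_sq_eq_zero hc' (by rw [← comp_mul_eq_iff.1 hf, hxx, map_zero])

theorem IsFrobenius.map_mem_orthogonal_jacobson (h : IsFrobenius μ) (hc : IsComm μ)
    (h' : IsFrobenius γ) (hc' : IsComm γ) (hf : f ∘L μ = γ ∘L hmap f f) {x : H}
    (hx : x ∈ (jacobson μ)ᗮ) : f x ∈ (jacobson γ)ᗮ := by
  rw [h.orthogonal_jacobson_eq_closure_range hc] at hx
  rw [h'.orthogonal_jacobson_eq_closure_range hc']
  refine map_mem_closure f.continuous hx ?_
  rintro _ ⟨t, rfl⟩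
  exact ⟨hmap f f t, (DFunLike.congr_fun hf t).symm⟩

theorem IsFrobenius.comp_mul_eq_of_orthogonal_jacobson (h : IsFrobenius μ) (hc : IsComm μ)
    (h' : IsFrobenius γ) (hc' : IsComm γ) (hJ : ∀ x ∈ jacobson μ, f x ∈ jacobson γ)
    (hmul : ∀ x ∈ (jacobson μ)ᗮ, ∀ y ∈ (jacobson μ)ᗮ,
      f (μ (htmul x y)) = γ (htmul (f x) (f y))) : f ∘L μ = γ ∘L hmap f f := by
  have := (h.isClosed_jacobson hc).completeSpace_coe
  have hann (x : H) : Set.EqOn (f ∘L lmul μ x) (lmul γ (f x) ∘L f) (jacobson μ) := fun y hy => by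
    have hxy : lmul μ x y = 0 := by rw [hc.lmul_comm, (h.mem_jacobson_iff hc).1 hy, zero_apply]
    have hfxy : lmul γ (f x) (f y) = 0 := by
      rw [hc'.lmul_comm, (h'.mem_jacobson_iff hc').1 (hJ y hy), zero_apply]
    rw [ContinuousLinearMap.comp_apply, ContinuousLinearMap.comp_apply, hxy, hfxy, map_zero]
  have hcompl := (Submodule.isCompl_orthogonal (jacobson μ)).codisjoint
  have hperp (x : H) (hx : x ∈ (jacobson μ)ᗮ) : f ∘L lmul μ x = lmul γ (f x) ∘L f :=
    LinearMap.ext_on_codisjoint hcompl (hann x) (hmul x hx)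
  have hall (x : H) : f ∘L lmul μ x = lmul γ (f x) ∘L f := by
    refine LinearMap.ext_on_codisjoint hcompl (hann x) fun y hy => ?_
    have hyx := DFunLike.congr_fun (hperp y hy) x
    simp only [ContinuousLinearMap.comp_apply, hc.lmul_comm y, hc'.lmul_comm (f y)] at hyx
    exact hyx
  exact comp_mul_eq_iff.2 fun x y => DFunLike.congr_fun (hall x) y

end Morphism

section Extension

variable {S E : Type*} [NormedAddCommGroup S] [InnerProductSpace ℂ S] [CompleteSpace S]
  [NormedAddCommGroup E] [InnerProductSpace ℂ E] [CompleteSpace E]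
  (i : S →ₗᵢ[ℂ] E) {μ : HTensor S S →L[ℂ] S}

theorem adjoint_isometry_apply (x : S) : (i.toContinuousLinearMap†) (i x) = x :=
  DFunLike.congr_fun i.adjoint_comp_self x

/-- The extension by zero of a product along an isometry `i`: it is transported to the range of
`i`, and multiplication by an element orthogonal to this range is zero. -/
def extendMul (i : S →ₗᵢ[ℂ] E) (μ : HTensor S S →L[ℂ] S) : HTensor E E →L[ℂ] E :=
  i.toContinuousLinearMap ∘L μ ∘L hmap (i.toContinuousLinearMap†) (i.toContinuousLinearMap†)

@[simp] theorem extendMul_htmul (μ : HTensor S S →L[ℂ] S) (x y : E) : extendMul i μ (htmul x y) =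
    i (μ (htmul ((i.toContinuousLinearMap†) x) ((i.toContinuousLinearMap†) y))) := by
  simp [extendMul]

theorem extendMul_htmul_apply (μ : HTensor S S →L[ℂ] S) (x y : S) :
    extendMul i μ (htmul (i x) (i y)) = i (μ (htmul x y)) := by
  rw [extendMul_htmul, adjoint_isometry_apply, adjoint_isometry_apply]

theorem lmul_extendMul (μ : HTensor S S →L[ℂ] S) (x : E) : lmul (extendMul i μ) x =
    i.toContinuousLinearMap ∘L lmul μ ((i.toContinuousLinearMap†) x) ∘L
      i.toContinuousLinearMap† :=
  ContinuousLinearMap.ext fun y => extendMul_htmul i μ x y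

theorem IsComm.extendMul (hc : IsComm μ) : IsComm (extendMul i μ) := by
  rw [isComm_iff] at hc ⊢
  intro x y
  rw [extendMul_htmul, extendMul_htmul, hc]

theorem IsFrobenius.extendMul (h : IsFrobenius μ) : IsFrobenius (extendMul i μ) := by
  rw [isFrobenius_iff_adjoint_lmul] at h ⊢
  intro x u v
  simp [lmul_extendMul, ContinuousLinearMap.adjoint_comp, adjoint_isometry_apply, h]

theorem IsFrobenius.mem_jacobson_extendMul_iff (h : IsFrobenius μ) (hc : IsComm μ) {x : E} :
    x ∈ jacobson (HilbFrob.extendMul i μ) ↔ (i.toContinuousLinearMap†) x ∈ jacobson μ := by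
  rw [(h.extendMul i).mem_jacobson_iff (hc.extendMul i), h.mem_jacobson_iff hc, lmul_extendMul]
  refine ⟨fun hx => ContinuousLinearMap.ext fun s => i.injective ?_, fun hx => by simp [hx]⟩
  simpa [adjoint_isometry_apply] using DFunLike.congr_fun hx (i s)

theorem IsFrobenius.jacobson_extendMul_of_jacobson_eq_bot (h : IsFrobenius μ) (hc : IsComm μ)
    (hss : jacobson μ = ⊥) : jacobson (HilbFrob.extendMul i μ) = i.rangeᗮ := by
  ext x
  rw [h.mem_jacobson_extendMul_iff i hc, hss, Submodule.mem_bot]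
  exact (SetLike.ext_iff.1 i.toContinuousLinearMap.orthogonal_range x).symm

theorem IsFrobenius.orthogonal_jacobson_extendMul_of_jacobson_eq_bot (h : IsFrobenius μ)
    (hc : IsComm μ) (hss : jacobson μ = ⊥) :
    (jacobson (HilbFrob.extendMul i μ))ᗮ = i.range := by
  have : IsClosed (i.range : Set E) := i.isometry.isClosedEmbedding.isClosed_range
  have := this.completeSpace_coe
  rw [h.jacobson_extendMul_of_jacobson_eq_bot i hc hss]
  exact Submodule.orthogonal_orthogonal _

end Extension

section Sum

variable (S Z : Type*) [NormedAddCommGroup S] [InnerProductSpace ℂ S]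
  [NormedAddCommGroup Z] [InnerProductSpace ℂ Z]

/-- The isometric inclusion of the first summand of an orthogonal sum. -/
def inlₗᵢ : S →ₗᵢ[ℂ] WithLp 2 (S × Z) where
  toLinearMap := (WithLp.linearEquiv 2 ℂ (S × Z)).symm.toLinearMap ∘ₗ LinearMap.inl ℂ S Z
  norm_map' x := by simp

/-- The isometric inclusion of the second summand of an orthogonal sum. -/
def inrₗᵢ : Z →ₗᵢ[ℂ] WithLp 2 (S × Z) where
  toLinearMap := (WithLp.linearEquiv 2 ℂ (S × Z)).symm.toLinearMap ∘ₗ LinearMap.inr ℂ S Z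
  norm_map' x := by simp

theorem orthogonal_range_inlₗᵢ : (inlₗᵢ S Z).rangeᗮ = (inrₗᵢ S Z).range := by
  ext x
  constructor
  · intro hx
    refine ⟨x.snd, WithLp.ofLp_injective 2 (Prod.ext ?_ rfl)⟩
    refine (inner_self_eq_zero (𝕜 := ℂ).1 ?_).symm
    simpa [inlₗᵢ] using (Submodule.mem_orthogonal _ _).1 hx _ ⟨x.fst, rfl⟩
  · rintro ⟨z, rfl⟩ _ ⟨s, rfl⟩
    simp [inlₗᵢ, inrₗᵢ]

end Sum

theorem isSubalgebra_orthogonal_radical (X : CFrobSem.{u}) :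
    IsSubalgebra X.obj.mul (radical X)ᗮ :=
  X.property.isSubalgebra_orthogonal_jacobson X.obj.comm

theorem isFrobenius_restrictMul_orthogonal_radical (X : CFrobSem.{u}) :
    IsFrobenius (restrictMul X.obj.mul (radical X)ᗮ (isSubalgebra_orthogonal_radical X)) :=
  X.property.restrict_orthogonal_jacobson X.obj.comm _

theorem jacobson_restrictMul_orthogonal_radical (X : CFrobSem.{u}) :
    jacobson (restrictMul X.obj.mul (radical X)ᗮ (isSubalgebra_orthogonal_radical X)) = ⊥ :=
  X.property.jacobson_restrict_orthogonal_jacobson X.obj.comm _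

theorem isClosed_radical (X : CFrobSem.{u}) : IsClosed (radical X : Set X.obj.carrier) :=
  X.property.isClosed_jacobson X.obj.comm

instance (X : CFrobSem.{u}) : CompleteSpace (radical X) :=
  (isClosed_radical X).completeSpace_coe

theorem map_mem_radical (X Y : CFrobSem.{u}) (f : X ⟶ Y) :
    ∀ x ∈ radical X, f.hom.toCLM x ∈ radical Y := fun _ =>
  X.property.map_mem_jacobson X.obj.comm Y.property Y.obj.comm f.hom.map_mul

theorem map_mem_orthogonal_radical (X Y : CFrobSem.{u}) (f : X ⟶ Y) :
    ∀ x ∈ (radical X)ᗮ, f.hom.toCLM x ∈ (radical Y)ᗮ := fun _ =>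
  X.property.map_mem_orthogonal_jacobson X.obj.comm Y.property Y.obj.comm f.hom.map_mul

/-- The functor `(H, μ) ↦ ((Jᗮ, μ|Jᗮ), J)`, restricting a morphism to both summands. -/
def radicalDecomposition : CFrobSem.{u} ⥤ SemisimpleCFrobSem.{u} × Hilb.{u} :=
  Functor.prod'
    (functorP isSubalgebra_orthogonal_radical isFrobenius_restrictMul_orthogonal_radical
      jacobson_restrictMul_orthogonal_radical map_mem_orthogonal_radical)
    (functorJ isClosed_radical map_mem_radical)

instance : radicalDecomposition.{u}.Faithful where
  map_injective {X Y} f g hfg := by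
    have hP (x : X.obj.carrier) (hx : x ∈ (radical X)ᗮ) : f.hom.toCLM x = g.hom.toCLM x :=
      congrArg (fun k => ((Prod.fst k).hom.hom.toCLM ⟨x, hx⟩).1) hfg
    have hJ (x : X.obj.carrier) (hx : x ∈ radical X) : f.hom.toCLM x = g.hom.toCLM x :=
      congrArg (fun k => ((Prod.snd k).toCLM ⟨x, hx⟩).1) hfg
    exact InducedCategory.Hom.ext <| CSem.Hom.ext <|
      LinearMap.ext_on_codisjoint (Submodule.isCompl_orthogonal (radical X)).codisjoint hJ hP

instance : radicalDecomposition.{u}.Full where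
  map_surjective {X Y} := by
    rintro ⟨g, h⟩
    let gP : ↥(radical X)ᗮ →L[ℂ] ↥(radical Y)ᗮ := g.hom.hom.toCLM
    let hJ : radical X →L[ℂ] radical Y := h.toCLM
    let f : X.obj.carrier →L[ℂ] Y.obj.carrier := .ofIsTopCompl (radical X).isTopCompl_orthogonal
      ((radical Y).subtypeL ∘L hJ) ((radical Y)ᗮ.subtypeL ∘L gP)
    have hfJ (x : radical X) : f x = hJ x := ContinuousLinearMap.ofIsTopCompl_apply_left ..
    have hfP (x : ↥(radical X)ᗮ) : f x = gP x := ContinuousLinearMap.ofIsTopCompl_apply_right ..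
    have hgP : gP ∘L restrictMul X.obj.mul _ (isSubalgebra_orthogonal_radical X) =
        restrictMul Y.obj.mul _ (isSubalgebra_orthogonal_radical Y) ∘L hmap gP gP :=
      g.hom.hom.map_mul
    have hf : f ∘L X.obj.mul = Y.obj.mul ∘L hmap f f := by
      refine X.property.comp_mul_eq_of_orthogonal_jacobson X.obj.comm Y.property Y.obj.comm
        (fun x hx => hfJ ⟨x, hx⟩ ▸ (hJ ⟨x, hx⟩).2) fun x hx y hy => ?_
      have hxy := congrArg Subtype.val (comp_mul_eq_iff.1 hgP ⟨x, hx⟩ ⟨y, hy⟩)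
      rwa [← hfP, coe_restrictMul_htmul, coe_restrictMul_htmul, ← hfP, ← hfP] at hxy
    refine ⟨ObjectProperty.homMk ⟨f, hf⟩, Prod.ext ?_ ?_⟩
    · exact InducedCategory.Hom.ext <| InducedCategory.Hom.ext <| CSem.Hom.ext <|
        ContinuousLinearMap.ext fun x => Subtype.ext (hfP x)
    · exact Hilb.Hom.ext <| ContinuousLinearMap.ext fun x => Subtype.ext (hfJ x)

/-- A multiplicative bounded linear equivalence, as an isomorphism of semigroups. -/
def CSem.isoMk {X Y : CSem.{u}} (e : X.carrier ≃L[ℂ] Y.carrier)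
    (he : ∀ x y, e (X.mul (htmul x y)) = Y.mul (htmul (e x) (e y))) : X ≅ Y where
  hom := ⟨e, comp_mul_eq_iff.2 he⟩
  inv := ⟨e.symm, comp_mul_eq_iff.2 fun x y => e.injective (by simp [he])⟩
  hom_inv_id := CSem.Hom.ext e.coe_symm_comp_coe
  inv_hom_id := CSem.Hom.ext e.coe_comp_coe_symm

/-- A bounded linear equivalence, as an isomorphism of Hilbert spaces. -/
def Hilb.isoMk {H K : Hilb.{u}} (e : H.carrier ≃L[ℂ] K.carrier) : H ≅ K where
  hom := ⟨e⟩
  inv := ⟨e.symm⟩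
  hom_inv_id := Hilb.Hom.ext e.coe_symm_comp_coe
  inv_hom_id := Hilb.Hom.ext e.coe_comp_coe_symm

/-- The orthogonal sum of a Frobenius semigroup and a Hilbert space with zero product. -/
def CFrobSem.sumZero (X : CFrobSem.{u}) (Z : Hilb.{u}) : CFrobSem.{u} where
  obj :=
    { carrier := WithLp 2 (X.obj.carrier × Z.carrier)
      mul := extendMul (inlₗᵢ X.obj.carrier Z.carrier) X.obj.mul
      assoc := (X.property.extendMul _).isAssoc (X.obj.comm.extendMul _)
      comm := X.obj.comm.extendMul _ }
  property := X.property.extendMul _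

theorem orthogonal_radical_sumZero (S : SemisimpleCFrobSem.{u}) (Z : Hilb.{u}) :
    (radical (S.obj.sumZero Z))ᗮ = (inlₗᵢ S.obj.obj.carrier Z.carrier).range :=
  S.obj.property.orthogonal_jacobson_extendMul_of_jacobson_eq_bot _ S.obj.obj.comm S.property

theorem radical_sumZero (S : SemisimpleCFrobSem.{u}) (Z : Hilb.{u}) :
    radical (S.obj.sumZero Z) = (inrₗᵢ S.obj.obj.carrier Z.carrier).range :=
  (S.obj.property.jacobson_extendMul_of_jacobson_eq_bot _ S.obj.obj.comm S.property).trans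
    (orthogonal_range_inlₗᵢ _ _)

instance : radicalDecomposition.{u}.EssSurj where
  mem_essImage := by
    rintro ⟨S, Z⟩
    let i := inlₗᵢ S.obj.obj.carrier Z.carrier
    let X := S.obj.sumZero Z
    let eP : S.obj.obj.carrier ≃ₗᵢ[ℂ] ↥(radical X)ᗮ :=
      i.equivRange.trans (.ofEq _ _ (orthogonal_radical_sumZero S Z).symm)
    let eJ : Z.carrier ≃ₗᵢ[ℂ] radical X :=
      (inrₗᵢ S.obj.obj.carrier Z.carrier).equivRange.trans (.ofEq _ _ (radical_sumZero S Z).symm)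
    have heP (x y) : eP (S.obj.obj.mul (htmul x y)) =
        restrictMul X.obj.mul _ (isSubalgebra_orthogonal_radical X) (htmul (eP x) (eP y)) :=
      Subtype.ext <| (extendMul_htmul_apply i _ x y).symm.trans
        (coe_restrictMul_htmul _ _ _ (eP x) (eP y)).symm
    exact ⟨X, ⟨Iso.symm (.prod (ObjectProperty.isoMk _ (ObjectProperty.isoMk _
      (CSem.isoMk eP.toContinuousLinearEquiv heP))) (Hilb.isoMk eJ.toContinuousLinearEquiv))⟩⟩

instance : radicalDecomposition.{u}.IsEquivalence where

end HilbFrob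

end

theorem mainTheorem6 :
    ∃ (hsub : ∀ X : HilbFrob.CFrobSem.{u},
        HilbFrob.IsSubalgebra X.obj.mul (HilbFrob.radical X)ᗮ)
      (hfrob : ∀ X : HilbFrob.CFrobSem.{u},
        HilbFrob.IsFrobenius (HilbFrob.restrictMul X.obj.mul (HilbFrob.radical X)ᗮ (hsub X)))
      (hss : ∀ X : HilbFrob.CFrobSem.{u},
        HilbFrob.jacobson (HilbFrob.restrictMul X.obj.mul (HilbFrob.radical X)ᗮ (hsub X)) = ⊥)
      (hmapsP : ∀ (X Y : HilbFrob.CFrobSem.{u}) (f : X ⟶ Y),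
        ∀ x ∈ (HilbFrob.radical X)ᗮ, f.hom.toCLM x ∈ (HilbFrob.radical Y)ᗮ)
      (hclosed : ∀ X : HilbFrob.CFrobSem.{u},
        IsClosed (HilbFrob.radical X : Set X.obj.carrier))
      (hmapsJ : ∀ (X Y : HilbFrob.CFrobSem.{u}) (f : X ⟶ Y),
        ∀ x ∈ HilbFrob.radical X, f.hom.toCLM x ∈ HilbFrob.radical Y),
      (CategoryTheory.Functor.prod' (HilbFrob.functorP hsub hfrob hss hmapsP)
        (HilbFrob.functorJ hclosed hmapsJ)).IsEquivalence :=
  ⟨HilbFrob.isSubalgebra_orthogonal_radical,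
    HilbFrob.isFrobenius_restrictMul_orthogonal_radical,
    HilbFrob.jacobson_restrictMul_orthogonal_radical, HilbFrob.map_mem_orthogonal_radical,
    HilbFrob.isClosed_radical, HilbFrob.map_mem_radical,
    inferInstanceAs HilbFrob.radicalDecomposition.IsEquivalence⟩
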